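/- Let $G$ be a finite group and let $T$ be a $G$-Tambara functor, with restrictions $\mathrm{res}_f=T(R_f)$, transfers $\mathrm{tr}_f=T(T_f)$ and norms $\mathrm{nm}_f=T(N_f)$ for maps $f$ of finite $G$-sets. For $H\le G$ let $\mathrm{res}^H_e\colon T(G/H)\to T(G/e)$ be the restriction along the quotient map $G/e\to G/H$, and for $g\in G$ let $\mathrm{conj}_g\colon T(G/e)\to T(G/e)$ be the isomorphism induced by the automorphism $c_g\colon G/e\to G/e$, $c_g(y)=yg^{-1}$, that is, $\mathrm{conj}_g=\mathrm{tr}_{c_g}=\mathrm{nm}_{c_g}=\mathrm{res}_{c_g^{-1}}$. For $x\in T(G/H)$ let $T\to T[1/x]$ be the localization of $T$ at $x$, i.e. the initial morphism of $G$-Tambara functors out of $T$ that sends $x$ to a unit. Call $x$ a kilpotent if $T[1/x]=0$, i.e. $T[1/x](G/K)=0$ for all $K\le G$. Let $H\le G$ and $x\in T(G/H)$. Then $x$ is a kilpotent if and only if \[\prod_{g\in G}\mathrm{conj}_g\,\mathrm{res}^H_e(x)\] is a nilpotent element of the commutative ring $T(G/e)$. -/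

import Mathlib

universe u v

/-- A finite `G`-set. -/
structure FinGSet (G : Type u) [Group G] : Type (u + 1) where
  /-- the underlying set -/
  carrier : Type u
  [action : MulAction G carrier]
  [finite : Finite carrier]

namespace FinGSet

variable {G : Type u} [Group G]

instance : CoeSort (FinGSet.{u} G) (Type u) := ⟨FinGSet.carrier⟩

instance (X : FinGSet.{u} G) : MulAction G X := X.action

instance (X : FinGSet.{u} G) : Finite X := X.finite

/-- The transitive `G`-set `G/H`. -/
def orbit [Finite G] (H : Subgroup G) : FinGSet.{u} G where
  carrier := G ⧸ H

/-- The disjoint union `X ⨿ Y`. -/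
def sum (X Y : FinGSet.{u} G) : FinGSet.{u} G where
  carrier := X ⊕ Y

/-- The first inclusion `X → X ⨿ Y`. -/
def inl (X Y : FinGSet.{u} G) : X →[G] X.sum Y where
  toFun x := (Sum.inl x : X ⊕ Y)
  map_smul' _ _ := rfl

/-- The second inclusion `Y → X ⨿ Y`. -/
def inr (X Y : FinGSet.{u} G) : Y →[G] X.sum Y where
  toFun y := (Sum.inr y : X ⊕ Y)
  map_smul' _ _ := rfl

/-- The fold map `∇ : X ⨿ X → X`. -/
def fold (X : FinGSet.{u} G) : X.sum X →[G] X where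
  toFun := Sum.elim id id
  map_smul' g x := by cases x <;> rfl

/-- For `H ≤ K`, the canonical quotient map `G/H → G/K`, `xH ↦ xK`. -/
def quotientMap [Finite G] {H K : Subgroup G} (h : H ≤ K) : orbit H →[G] orbit K where
  toFun := Quotient.map' (s₁ := QuotientGroup.leftRel H) (s₂ := QuotientGroup.leftRel K) id
    fun a b hab => by
      rw [QuotientGroup.leftRel_apply] at hab ⊢
      exact h hab
  map_smul' g x := by
    induction x using Quotient.inductionOn' with
    | h a => rfl

/-- If `K = gHg⁻¹`, the canonical isomorphism `c : G/H → G/K`, `xH ↦ xg⁻¹K`. -/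
def conjMap [Finite G] {H K : Subgroup G} (g : G) (h : ∀ a, a ∈ K ↔ g⁻¹ * a * g ∈ H) :
    orbit H →[G] orbit K where
  toFun := Quotient.map' (s₁ := QuotientGroup.leftRel H) (s₂ := QuotientGroup.leftRel K)
    (fun x => x * g⁻¹)
    fun a b hab => by
      rw [QuotientGroup.leftRel_apply] at hab ⊢
      rw [h]
      simpa [mul_assoc] using hab
  map_smul' k x := by
    induction x using Quotient.inductionOn' with
    | h a => exact congrArg (Quotient.mk'' (s₁ := QuotientGroup.leftRel K)) (mul_assoc k a g⁻¹)

/-- The commutative square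
```
P --f'--> X'
|g'       |g
v         v
X --f---> Y
```
is a pullback square of `G`-sets, i.e. `P` maps bijectively to the fibre product `X ×_Y X'`. -/
structure IsPullback {P X X' Y : FinGSet.{u} G} (g' : P →[G] X) (f' : P →[G] X')
    (f : X →[G] Y) (g : X' →[G] Y) : Prop where
  comm : ∀ p, f (g' p) = g (f' p)
  existsUnique : ∀ x x', f x = g x' → ∃! p, g' p = x ∧ f' p = x'

/-- For `g : X → Y` and `f : Y → Z`, the diagram
```
     E --q--> P
  e/ |        |p
  X  |g ∘ e   |
  g\ v        v
     Y --f--> Z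
```
is an exponential diagram: `p : P → Z` is the dependent product `Π_f g`, whose fibre over `z`
is the set of sections `s : f⁻¹(z) → X` of `g`, `E` is the pullback of `P` to `Y`, and `e` is the
evaluation map (the counit of the adjunction `f^* ⊣ Π_f`). In other words the square is a
pullback, and for every `z` each section `s` of `g` over `f⁻¹(z)` comes from exactly one point `b`
of `P` over `z`, in the sense that `e` restricts to `s` on `q⁻¹(b) ≃ f⁻¹(z)`. -/
structure IsExponential {X Y Z E P : FinGSet.{u} G} (f : Y →[G] Z) (g : X →[G] Y)
    (e : E →[G] X) (q : E →[G] P) (p : P →[G] Z) : Prop where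
  isPullback : IsPullback q (g.comp e) p f
  existsUnique : ∀ (z : Z) (s : {y : Y // f y = z} → X), (∀ y, g (s y) = y) →
    ∃! b : P, p b = z ∧ ∀ (a : E) (h : f (g (e a)) = z), q a = b → e a = s ⟨g (e a), h⟩

end FinGSet

open FinGSet in
/-- A `G`-Tambara functor. A functor from the category of bispans of finite `G`-sets to sets
amounts to sets `obj X` with restrictions (`S(R_f)`), transfers (`S(T_f)`) and norms (`S(N_f)`),
functorial in `f` and compatible with each other along pullback squares and exponential diagrams.
It preserves finite products if `obj ∅` is a point and
`obj (X ⨿ Y) → obj X × obj Y` is bijective. Then `obj X` carries the operations `S(T_∇)` and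
`S(N_∇)` on `obj (X ⨿ X) ≃ obj X × obj X`, and these have to be the addition and the
multiplication of a commutative ring. -/
structure TambaraFunctor (G : Type u) [Group G] : Type (max (u + 1) (v + 1)) where
  /-- the levels -/
  obj : FinGSet.{u} G → Type v
  [commRing : ∀ X, CommRing (obj X)]
  /-- restriction -/
  res : ∀ {X Y : FinGSet.{u} G}, (X →[G] Y) → obj Y → obj X
  /-- transfer -/
  tr : ∀ {X Y : FinGSet.{u} G}, (X →[G] Y) → obj X → obj Y
  /-- norm -/
  nm : ∀ {X Y : FinGSet.{u} G}, (X →[G] Y) → obj X → obj Y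
  res_id : ∀ {X : FinGSet.{u} G} (a : obj X), res (MulActionHom.id G) a = a
  tr_id : ∀ {X : FinGSet.{u} G} (a : obj X), tr (MulActionHom.id G) a = a
  nm_id : ∀ {X : FinGSet.{u} G} (a : obj X), nm (MulActionHom.id G) a = a
  res_comp : ∀ {X Y Z : FinGSet.{u} G} (f : Y →[G] Z) (g : X →[G] Y) (a : obj Z),
    res (f.comp g) a = res g (res f a)
  tr_comp : ∀ {X Y Z : FinGSet.{u} G} (f : Y →[G] Z) (g : X →[G] Y) (a : obj X),
    tr (f.comp g) a = tr f (tr g a)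
  nm_comp : ∀ {X Y Z : FinGSet.{u} G} (f : Y →[G] Z) (g : X →[G] Y) (a : obj X),
    nm (f.comp g) a = nm f (nm g a)
  res_tr : ∀ {P X X' Y : FinGSet.{u} G} {g' : P →[G] X} {f' : P →[G] X'} {f : X →[G] Y}
    {g : X' →[G] Y}, IsPullback g' f' f g → ∀ a : obj X', res f (tr g a) = tr g' (res f' a)
  res_nm : ∀ {P X X' Y : FinGSet.{u} G} {g' : P →[G] X} {f' : P →[G] X'} {f : X →[G] Y}
    {g : X' →[G] Y}, IsPullback g' f' f g → ∀ a : obj X', res f (nm g a) = nm g' (res f' a)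
  nm_tr : ∀ {X Y Z E P : FinGSet.{u} G} {f : Y →[G] Z} {g : X →[G] Y} {e : E →[G] X}
    {q : E →[G] P} {p : P →[G] Z}, IsExponential f g e q p →
    ∀ a : obj X, nm f (tr g a) = tr p (nm q (res e a))
  subsingleton_of_isEmpty : ∀ X : FinGSet.{u} G, IsEmpty X → Subsingleton (obj X)
  bijective_sum : ∀ X Y : FinGSet.{u} G,
    Function.Bijective fun c : obj (X.sum Y) => (res (inl X Y) c, res (inr X Y) c)
  tr_fold : ∀ (X : FinGSet.{u} G) (c : obj (X.sum X)),
    tr (fold X) c = res (inl X X) c + res (inr X X) c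
  nm_fold : ∀ (X : FinGSet.{u} G) (c : obj (X.sum X)),
    nm (fold X) c = res (inl X X) c * res (inr X X) c

namespace TambaraFunctor

variable {G : Type u} [Group G]

instance (T : TambaraFunctor.{u, v} G) (X : FinGSet.{u} G) : CommRing (T.obj X) := T.commRing X

/-- A morphism of Tambara functors is a natural transformation. -/
@[ext]
structure Hom (S T : TambaraFunctor.{u, v} G) where
  /-- the components -/
  app : ∀ X : FinGSet.{u} G, S.obj X → T.obj X
  app_res : ∀ {X Y : FinGSet.{u} G} (f : X →[G] Y) (a : S.obj Y),
    app X (S.res f a) = T.res f (app Y a)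
  app_tr : ∀ {X Y : FinGSet.{u} G} (f : X →[G] Y) (a : S.obj X),
    app Y (S.tr f a) = T.tr f (app X a)
  app_nm : ∀ {X Y : FinGSet.{u} G} (f : X →[G] Y) (a : S.obj X),
    app Y (S.nm f a) = T.nm f (app X a)

/-- Composition of morphisms of Tambara functors. -/
def Hom.comp {R S T : TambaraFunctor.{u, v} G} (ψ : Hom S T) (φ : Hom R S) : Hom R T where
  app X a := ψ.app X (φ.app X a)
  app_res f a := by rw [φ.app_res, ψ.app_res]
  app_tr f a := by rw [φ.app_tr, ψ.app_tr]
  app_nm f a := by rw [φ.app_nm, ψ.app_nm]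

/-- `φ : T → L` exhibits `L` as the localization `T[1/x]`: it is initial among all morphisms of
Tambara functors that send `x` to a unit. -/
structure IsLocalizationAway {T L : TambaraFunctor.{u, v} G} {X : FinGSet.{u} G} (x : T.obj X)
    (φ : Hom T L) : Prop where
  isUnit : IsUnit (φ.app X x)
  existsUnique : ∀ (S : TambaraFunctor.{u, v} G) (ψ : Hom T S), IsUnit (ψ.app X x) →
    ∃! χ : Hom L S, χ.comp φ = ψ

section Basic

/-! ### Elementary facts, needed for the existence of localizations -/

open FinGSet

variable (T : TambaraFunctor.{u, v} G)

theorem exists_pair {X Y : FinGSet.{u} G} (a : T.obj X) (b : T.obj Y) :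
    ∃ c : T.obj (X.sum Y), T.res (inl X Y) c = a ∧ T.res (inr X Y) c = b := by
  obtain ⟨c, hc⟩ := (T.bijective_sum X Y).2 (a, b)
  exact ⟨c, congrArg Prod.fst hc, congrArg Prod.snd hc⟩

theorem sum_ext {X Y : FinGSet.{u} G} {c d : T.obj (X.sum Y)}
    (h₁ : T.res (inl X Y) c = T.res (inl X Y) d)
    (h₂ : T.res (inr X Y) c = T.res (inr X Y) d) : c = d :=
  (T.bijective_sum X Y).1 (Prod.ext h₁ h₂)

/-- The map `X ⨿ Y → Z` with components `f` and `g`. -/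
def _root_.FinGSet.desc {X Y Z : FinGSet.{u} G} (f : X →[G] Z) (g : Y →[G] Z) :
    X.sum Y →[G] Z where
  toFun := Sum.elim f g
  map_smul' k x := by
    cases x with
    | inl x => exact map_smul f k x
    | inr y => exact map_smul g k y

/-- The map `f ⨿ g`. -/
def _root_.FinGSet.sumMap {X Y X' Y' : FinGSet.{u} G} (f : X →[G] X') (g : Y →[G] Y') :
    X.sum Y →[G] X'.sum Y' := desc ((inl X' Y').comp f) ((inr X' Y').comp g)

theorem isPullback_inl {X Y X' Y' : FinGSet.{u} G} (f : X →[G] X') (g : Y →[G] Y') :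
    IsPullback f (inl X Y) (inl X' Y') (sumMap f g) where
  comm _ := rfl
  existsUnique x' c h := by
    rcases c with x | y
    · exact ⟨x, ⟨(Sum.inl_injective h).symm, rfl⟩, fun p hp => Sum.inl_injective hp.2⟩
    · exact absurd h Sum.inl_ne_inr

theorem isPullback_inr {X Y X' Y' : FinGSet.{u} G} (f : X →[G] X') (g : Y →[G] Y') :
    IsPullback g (inr X Y) (inr X' Y') (sumMap f g) where
  comm _ := rfl
  existsUnique y' c h := by
    rcases c with x | y
    · exact absurd h Sum.inr_ne_inl
    · exact ⟨y, ⟨(Sum.inr_injective h).symm, rfl⟩, fun p hp => Sum.inr_injective hp.2⟩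

theorem desc_eq {X Y Z : FinGSet.{u} G} (f : X →[G] Z) (g : Y →[G] Z) :
    desc f g = (fold Z).comp (sumMap f g) := by
  ext c
  rcases c with x | y <;> rfl

theorem nm_desc {X Y Z : FinGSet.{u} G} (f : X →[G] Z) (g : Y →[G] Z) (c : T.obj (X.sum Y)) :
    T.nm (desc f g) c = T.nm f (T.res (inl X Y) c) * T.nm g (T.res (inr X Y) c) := by
  rw [desc_eq, T.nm_comp, T.nm_fold, T.res_nm (isPullback_inl f g),
    T.res_nm (isPullback_inr f g)]

theorem tr_desc {X Y Z : FinGSet.{u} G} (f : X →[G] Z) (g : Y →[G] Z) (c : T.obj (X.sum Y)) :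
    T.tr (desc f g) c = T.tr f (T.res (inl X Y) c) + T.tr g (T.res (inr X Y) c) := by
  rw [desc_eq, T.tr_comp, T.tr_fold, T.res_tr (isPullback_inl f g),
    T.res_tr (isPullback_inr f g)]

theorem fold_eq (X : FinGSet.{u} G) :
    fold X = desc (MulActionHom.id G : X →[G] X) (MulActionHom.id G) := rfl

theorem comp_desc {X Y Z W : FinGSet.{u} G} (k : Z →[G] W) (f : X →[G] Z) (g : Y →[G] Z) :
    k.comp (desc f g) = desc (k.comp f) (k.comp g) := by
  ext c
  rcases c with x | y <;> rfl

theorem desc_comp_inl {X Y Z : FinGSet.{u} G} (f : X →[G] Z) (g : Y →[G] Z) :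
    (desc f g).comp (inl X Y) = f := rfl

theorem desc_comp_inr {X Y Z : FinGSet.{u} G} (f : X →[G] Z) (g : Y →[G] Z) :
    (desc f g).comp (inr X Y) = g := rfl

theorem res_add {X Y : FinGSet.{u} G} (f : X →[G] Y) (a b : T.obj Y) :
    T.res f (a + b) = T.res f a + T.res f b := by
  obtain ⟨c, rfl, rfl⟩ := T.exists_pair a b
  have h : IsPullback (fold X) (sumMap f f) f (fold Y) := by
    refine ⟨?_, ?_⟩
    · rintro (x | x) <;> rfl
    · rintro x (y | y) h
      · refine ⟨Sum.inl x, ⟨rfl, congrArg Sum.inl h⟩, ?_⟩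
        rintro (p | p) ⟨h₁, h₂⟩
        · exact congrArg Sum.inl h₁
        · exact absurd h₂ Sum.inr_ne_inl
      · refine ⟨Sum.inr x, ⟨rfl, congrArg Sum.inr h⟩, ?_⟩
        rintro (p | p) ⟨h₁, h₂⟩
        · exact absurd h₂ Sum.inl_ne_inr
        · exact congrArg Sum.inr h₁
  rw [← T.tr_fold, T.res_tr h, T.tr_fold]
  rw [← T.res_comp, ← T.res_comp, ← T.res_comp, ← T.res_comp]
  rfl

theorem res_mul {X Y : FinGSet.{u} G} (f : X →[G] Y) (a b : T.obj Y) :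
    T.res f (a * b) = T.res f a * T.res f b := by
  obtain ⟨c, rfl, rfl⟩ := T.exists_pair a b
  have h : IsPullback (fold X) (sumMap f f) f (fold Y) := by
    refine ⟨?_, ?_⟩
    · rintro (x | x) <;> rfl
    · rintro x (y | y) h
      · refine ⟨Sum.inl x, ⟨rfl, congrArg Sum.inl h⟩, ?_⟩
        rintro (p | p) ⟨h₁, h₂⟩
        · exact congrArg Sum.inl h₁
        · exact absurd h₂ Sum.inr_ne_inl
      · refine ⟨Sum.inr x, ⟨rfl, congrArg Sum.inr h⟩, ?_⟩
        rintro (p | p) ⟨h₁, h₂⟩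
        · exact absurd h₂ Sum.inl_ne_inr
        · exact congrArg Sum.inr h₁
  rw [← T.nm_fold, T.res_nm h, T.nm_fold]
  rw [← T.res_comp, ← T.res_comp, ← T.res_comp, ← T.res_comp]
  rfl

/-- The empty `G`-set. -/
def _root_.FinGSet.empty (G : Type u) [Group G] : FinGSet.{u} G where
  carrier := PEmpty
  action := { smul := fun _ x => x, one_smul := fun x => x.elim, mul_smul := fun _ _ x => x.elim }

/-- The map `∅ → X`. -/
def _root_.FinGSet.fromEmpty (X : FinGSet.{u} G) : FinGSet.empty G →[G] X where
  toFun := PEmpty.elim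
  map_smul' _ x := PEmpty.elim x

theorem nm_fromEmpty (X : FinGSet.{u} G) (t : T.obj (FinGSet.empty G)) :
    T.nm (fromEmpty X) t = 1 := by
  obtain ⟨c, h₁, h₂⟩ := T.exists_pair t (1 : T.obj X)
  have h := T.nm_desc (fromEmpty X) (MulActionHom.id G) c
  rw [h₁, h₂, T.nm_id, mul_one] at h
  have hp : IsPullback (MulActionHom.id G : X →[G] X) (inr (FinGSet.empty G) X)
      (MulActionHom.id G) (desc (fromEmpty X) (MulActionHom.id G)) := by
    refine ⟨fun _ => rfl, ?_⟩
    rintro x (y | y) h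
    · exact y.elim
    · exact ⟨x, ⟨rfl, congrArg Sum.inr h⟩, fun p hp => hp.1⟩
  have h' := T.res_nm hp c
  rw [h₂, T.nm_id, T.res_id] at h'
  rw [← h, h']

theorem res_one {X Y : FinGSet.{u} G} (f : X →[G] Y) : T.res f 1 = 1 := by
  have hp : IsPullback (fromEmpty X) (MulActionHom.id G) f (fromEmpty Y) :=
    ⟨fun p => p.elim, fun _ p => p.elim⟩
  rw [← T.nm_fromEmpty Y 0, T.res_nm hp, T.nm_fromEmpty]

/-- Restriction as a ring homomorphism. -/
def resHom {X Y : FinGSet.{u} G} (f : X →[G] Y) : T.obj Y →+* T.obj X where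
  toFun := T.res f
  map_one' := T.res_one f
  map_mul' := T.res_mul f
  map_zero' := by simpa using T.res_add f 0 0
  map_add' := T.res_add f

theorem nm_mul {X Y : FinGSet.{u} G} (f : X →[G] Y) (a b : T.obj X) :
    T.nm f (a * b) = T.nm f a * T.nm f b := by
  obtain ⟨c, rfl, rfl⟩ := T.exists_pair a b
  rw [← T.nm_fold, ← T.nm_comp, fold_eq, comp_desc, T.nm_desc]
  rfl

theorem nm_one {X Y : FinGSet.{u} G} (f : X →[G] Y) : T.nm f 1 = 1 := by
  rw [← T.nm_fromEmpty X 0, ← T.nm_comp, ← T.nm_fromEmpty Y 0]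
  congr 1
  ext x
  exact x.elim

theorem tr_add {X Y : FinGSet.{u} G} (f : X →[G] Y) (a b : T.obj X) :
    T.tr f (a + b) = T.tr f a + T.tr f b := by
  obtain ⟨c, rfl, rfl⟩ := T.exists_pair a b
  rw [← T.tr_fold, ← T.tr_comp, fold_eq, comp_desc, T.tr_desc]
  rfl

/-- Frobenius reciprocity. -/
theorem tr_mul_res {X Y : FinGSet.{u} G} (f : X →[G] Y) (a : T.obj X) (b : T.obj Y) :
    T.tr f (a * T.res f b) = T.tr f a * b := by
  obtain ⟨c, rfl, rfl⟩ := T.exists_pair a b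
  have hE : IsExponential (fold Y) (sumMap f (MulActionHom.id G))
      (sumMap (MulActionHom.id G) f) (fold X) f := by
    refine ⟨⟨?_, ?_⟩, ?_⟩
    · rintro (x | x) <;> rfl
    · rintro x (y | y) h
      · refine ⟨Sum.inl x, ⟨rfl, congrArg Sum.inl h⟩, ?_⟩
        rintro (p | p) ⟨h₁, h₂⟩
        · exact congrArg Sum.inl h₁
        · exact absurd h₂ Sum.inr_ne_inl
      · refine ⟨Sum.inr x, ⟨rfl, congrArg Sum.inr h⟩, ?_⟩
        rintro (p | p) ⟨h₁, h₂⟩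
        · exact absurd h₂ Sum.inl_ne_inr
        · exact congrArg Sum.inr h₁
    · intro z s hs
      have h₁ := hs ⟨Sum.inl z, rfl⟩
      have h₂ := hs ⟨Sum.inr z, rfl⟩
      rcases hx : s ⟨Sum.inl z, rfl⟩ with x | y
      swap
      · rw [hx] at h₁
        exact absurd h₁ Sum.inr_ne_inl
      rcases hy : s ⟨Sum.inr z, rfl⟩ with x' | y
      · rw [hy] at h₂
        exact absurd h₂ Sum.inl_ne_inr
      rw [hx] at h₁
      rw [hy] at h₂
      have h₁' : f x = z := Sum.inl_injective h₁
      have h₂' : y = z := Sum.inr_injective h₂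
      refine ⟨x, ⟨h₁', ?_⟩, ?_⟩
      · rintro (a | a) h rfl
        · subst h₁'
          exact hx.symm
        · subst h₁'
          rw [h₂'] at hy
          exact hy.symm
      · rintro w ⟨hw, hw'⟩
        subst hw
        have := hw' (Sum.inl w) rfl rfl
        exact Sum.inl_injective (this.trans hx)
  have h := T.nm_tr hE c
  rw [T.nm_fold, T.res_tr (isPullback_inl f (MulActionHom.id G)),
    T.res_tr (isPullback_inr f (MulActionHom.id G)), T.tr_id, T.nm_fold, ← T.res_comp,
    ← T.res_comp] at h
  rw [h, ← T.res_comp]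
  rfl

/-- The complement of the diagonal in `X ×_Y X`. -/
def _root_.FinGSet.offDiag {X Y : FinGSet.{u} G} (f : X →[G] Y) : FinGSet.{u} G where
  carrier := {p : X × X // f p.1 = f p.2 ∧ p.1 ≠ p.2}
  action :=
    { smul := fun g p => ⟨(g • p.1.1, g • p.1.2), by
        rw [map_smul, map_smul, p.2.1], fun h => p.2.2 (MulAction.injective g h)⟩
      one_smul := fun p => Subtype.ext (Prod.ext (one_smul G _) (one_smul G _))
      mul_smul := fun g h p => Subtype.ext (Prod.ext (mul_smul g h _) (mul_smul g h _)) }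

/-- The first projection. -/
def _root_.FinGSet.offDiagFst {X Y : FinGSet.{u} G} (f : X →[G] Y) : offDiag f →[G] X where
  toFun p := p.1.1
  map_smul' _ _ := rfl

/-- The second projection. -/
def _root_.FinGSet.offDiagSnd {X Y : FinGSet.{u} G} (f : X →[G] Y) : offDiag f →[G] X where
  toFun p := p.1.2
  map_smul' _ _ := rfl

/-- The quotient of `res f (nm f s)` by `s`. -/
def cofactor {X Y : FinGSet.{u} G} (f : X →[G] Y) (s : T.obj X) : T.obj X :=
  T.nm (offDiagSnd f) (T.res (offDiagFst f) s)

theorem res_nm_self {X Y : FinGSet.{u} G} (f : X →[G] Y) (s : T.obj X) :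
    T.res f (T.nm f s) = s * T.cofactor f s := by
  have hp : IsPullback (desc (MulActionHom.id G) (offDiagSnd f))
      (desc (MulActionHom.id G) (offDiagFst f)) f f := by
    refine ⟨?_, ?_⟩
    · rintro (x | p)
      · rfl
      · exact p.2.1.symm
    · intro x y h
      by_cases hxy : y = x
      · subst hxy
        refine ⟨Sum.inl y, ⟨rfl, rfl⟩, ?_⟩
        rintro (z | p) ⟨h₁, h₂⟩
        · exact congrArg Sum.inl h₁
        · exact absurd (h₂.trans h₁.symm) p.2.2
      · refine ⟨Sum.inr ⟨(y, x), h.symm, hxy⟩, ⟨rfl, rfl⟩, ?_⟩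
        rintro (z | p) ⟨h₁, h₂⟩
        · exact absurd (h₂.symm.trans h₁) hxy
        · exact congrArg Sum.inr (Subtype.ext (Prod.ext h₂ h₁))
  rw [T.res_nm hp, T.nm_desc, ← T.res_comp, ← T.res_comp, desc_comp_inl, desc_comp_inr, T.nm_id,
    T.res_id]
  rfl

variable {T}

theorem Hom.map_mul {S : TambaraFunctor.{u, v} G} (φ : Hom T S) {X : FinGSet.{u} G}
    (a b : T.obj X) : φ.app X (a * b) = φ.app X a * φ.app X b := by
  obtain ⟨c, rfl, rfl⟩ := T.exists_pair a b
  rw [← T.nm_fold, φ.app_nm, S.nm_fold, φ.app_res, φ.app_res]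

theorem Hom.map_add {S : TambaraFunctor.{u, v} G} (φ : Hom T S) {X : FinGSet.{u} G}
    (a b : T.obj X) : φ.app X (a + b) = φ.app X a + φ.app X b := by
  obtain ⟨c, rfl, rfl⟩ := T.exists_pair a b
  rw [← T.tr_fold, φ.app_tr, S.tr_fold, φ.app_res, φ.app_res]

theorem Hom.map_one {S : TambaraFunctor.{u, v} G} (φ : Hom T S) (X : FinGSet.{u} G) :
    φ.app X 1 = 1 := by
  rw [← T.nm_fromEmpty X 0, φ.app_nm, S.nm_fromEmpty]

/-- The components of a morphism of Tambara functors are ring homomorphisms. -/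
def Hom.ringHom {S : TambaraFunctor.{u, v} G} (φ : Hom T S) (X : FinGSet.{u} G) :
    T.obj X →+* S.obj X where
  toFun := φ.app X
  map_one' := φ.map_one X
  map_mul' := φ.map_mul
  map_zero' := by simpa using φ.map_add (0 : T.obj X) 0
  map_add' := φ.map_add

end Basic

section Localization

/-! ### Existence of localizations, by inverting levelwise all elements that become units -/

open FinGSet

variable (T : TambaraFunctor.{u, v} G)

/-- The elements of `T(Y)` that become units in every `S` under every morphism `T → S` that sends
`x` to a unit. -/
def inverted {X : FinGSet.{u} G} (x : T.obj X) (Y : FinGSet.{u} G) : Submonoid (T.obj Y) where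
  carrier := {a | ∀ (S : TambaraFunctor.{u, v} G) (ψ : Hom T S), IsUnit (ψ.app X x) →
    IsUnit (ψ.app Y a)}
  one_mem' S ψ _ := by
    rw [ψ.map_one]
    exact isUnit_one
  mul_mem' ha hb S ψ h := by
    rw [ψ.map_mul]
    exact (ha S ψ h).mul (hb S ψ h)

variable {W : FinGSet.{u} G} (w : T.obj W)

theorem isUnit_res {X Y : FinGSet.{u} G} (f : X →[G] Y) {a : T.obj Y} (h : IsUnit a) :
    IsUnit (T.res f a) := h.map (T.resHom f)

theorem isUnit_nm {X Y : FinGSet.{u} G} (f : X →[G] Y) {a : T.obj X} (h : IsUnit a) :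
    IsUnit (T.nm f a) := by
  obtain ⟨b, hb⟩ := h.exists_right_inv
  exact IsUnit.of_mul_eq_one (T.nm f b) (by rw [← T.nm_mul, hb, T.nm_one])

theorem inverted_res {X Y : FinGSet.{u} G} (f : X →[G] Y) {a : T.obj Y}
    (h : a ∈ T.inverted w Y) : T.res f a ∈ T.inverted w X := fun S ψ hψ => by
  rw [ψ.app_res]
  exact S.isUnit_res f (h S ψ hψ)

theorem inverted_nm {X Y : FinGSet.{u} G} (f : X →[G] Y) {a : T.obj X}
    (h : a ∈ T.inverted w X) : T.nm f a ∈ T.inverted w Y := fun S ψ hψ => by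
  rw [ψ.app_nm]
  exact S.isUnit_nm f (h S ψ hψ)

theorem inverted_cofactor {X Y : FinGSet.{u} G} (f : X →[G] Y) {a : T.obj X}
    (h : a ∈ T.inverted w X) : T.cofactor f a ∈ T.inverted w X :=
  T.inverted_nm w _ (T.inverted_res w _ h)

theorem inverted_pair {X Y : FinGSet.{u} G} {c : T.obj (X.sum Y)}
    (h₁ : T.res (inl X Y) c ∈ T.inverted w X) (h₂ : T.res (inr X Y) c ∈ T.inverted w Y) :
    c ∈ T.inverted w (X.sum Y) := fun S ψ hψ => by
  have k₁ := h₁ S ψ hψ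
  have k₂ := h₂ S ψ hψ
  rw [ψ.app_res] at k₁ k₂
  obtain ⟨b₁, hb₁⟩ := k₁.exists_right_inv
  obtain ⟨b₂, hb₂⟩ := k₂.exists_right_inv
  obtain ⟨b, rfl, rfl⟩ := S.exists_pair b₁ b₂
  refine IsUnit.of_mul_eq_one b (S.sum_ext ?_ ?_)
  · rw [S.res_mul, hb₁, S.res_one]
  · rw [S.res_mul, hb₂, S.res_one]

/-- The levels of the localization. -/
abbrev LocObj (X : FinGSet.{u} G) : Type v := Localization (T.inverted w X)

variable {T w}

/-- The fraction `a / s`. -/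
abbrev frac {X : FinGSet.{u} G} (a s : T.obj X) (hs : s ∈ T.inverted w X) : LocObj T w X :=
  Localization.mk a ⟨s, hs⟩

theorem frac_eq {X : FinGSet.{u} G} {a b s r : T.obj X} {hs : s ∈ T.inverted w X}
    {hr : r ∈ T.inverted w X} :
    frac a s hs = frac b r hr ↔ ∃ c ∈ T.inverted w X, c * (r * a) = c * (s * b) := by
  rw [Localization.mk_eq_mk_iff, Localization.r_iff_exists]
  simp

theorem exists_frac {X : FinGSet.{u} G} (z : LocObj T w X) :
    ∃ a s, ∃ hs : s ∈ T.inverted w X, z = frac a s hs := by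
  induction z using Localization.induction_on with
  | H y => exact ⟨y.1, y.2.1, y.2.2, rfl⟩

theorem frac_eq_of_eq {X : FinGSet.{u} G} {a b s r : T.obj X} {hs : s ∈ T.inverted w X}
    {hr : r ∈ T.inverted w X} (h : r * a = s * b) : frac a s hs = frac b r hr :=
  frac_eq.2 ⟨1, one_mem _, by rw [h]⟩

variable (T w)

/-- Restriction of fractions. -/
def locRes {X Y : FinGSet.{u} G} (f : X →[G] Y) (z : LocObj T w Y) : LocObj T w X :=
  Localization.liftOn z (fun a s => frac (T.res f a) (T.res f s.1) (T.inverted_res w f s.2)) <| by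
    intro a b s r h
    obtain ⟨c, hc⟩ := Localization.r_iff_exists.1 h
    refine frac_eq.2 ⟨T.res f c.1, T.inverted_res w f c.2, ?_⟩
    rw [← T.res_mul, ← T.res_mul, ← T.res_mul, ← T.res_mul]
    exact congrArg (T.res f) hc

/-- Norm of fractions. -/
def locNm {X Y : FinGSet.{u} G} (f : X →[G] Y) (z : LocObj T w X) : LocObj T w Y :=
  Localization.liftOn z (fun a s => frac (T.nm f a) (T.nm f s.1) (T.inverted_nm w f s.2)) <| by
    intro a b s r h
    obtain ⟨c, hc⟩ := Localization.r_iff_exists.1 h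
    refine frac_eq.2 ⟨T.nm f c.1, T.inverted_nm w f c.2, ?_⟩
    rw [← T.nm_mul, ← T.nm_mul, ← T.nm_mul, ← T.nm_mul]
    exact congrArg (T.nm f) hc

/-- Transfer of fractions. -/
def locTr {X Y : FinGSet.{u} G} (f : X →[G] Y) (z : LocObj T w X) : LocObj T w Y :=
  Localization.liftOn z
    (fun a s => frac (T.tr f (a * T.cofactor f s.1)) (T.nm f s.1) (T.inverted_nm w f s.2)) <| by
    intro a b s r h
    obtain ⟨c, hc⟩ := Localization.r_iff_exists.1 h
    refine frac_eq.2 ⟨T.nm f c.1, T.inverted_nm w f c.2, ?_⟩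
    rw [← mul_assoc, ← mul_assoc, mul_comm _ (T.tr f _), mul_comm _ (T.tr f _), ← T.tr_mul_res,
      ← T.tr_mul_res, T.res_mul, T.res_mul, res_nm_self, res_nm_self, res_nm_self]
    congr 1
    linear_combination (T.cofactor f c.1 * T.cofactor f s.1 * T.cofactor f r.1) * hc

variable {T w}

@[simp]
theorem locRes_frac {X Y : FinGSet.{u} G} (f : X →[G] Y) (a s : T.obj Y)
    (hs : s ∈ T.inverted w Y) :
    locRes T w f (frac a s hs) = frac (T.res f a) (T.res f s) (T.inverted_res w f hs) := rfl

@[simp]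
theorem locNm_frac {X Y : FinGSet.{u} G} (f : X →[G] Y) (a s : T.obj X)
    (hs : s ∈ T.inverted w X) :
    locNm T w f (frac a s hs) = frac (T.nm f a) (T.nm f s) (T.inverted_nm w f hs) := rfl

theorem locTr_frac {X Y : FinGSet.{u} G} (f : X →[G] Y) (a : T.obj X) (t : T.obj Y)
    (ht : t ∈ T.inverted w Y) {s : T.obj X} (hs : s ∈ T.inverted w X) (h : s = T.res f t) :
    locTr T w f (frac a s hs) = frac (T.tr f a) t ht := by
  subst h
  refine frac_eq_of_eq (?_ : t * T.tr f (a * T.cofactor f (T.res f t)) = _)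
  rw [mul_comm, ← T.tr_mul_res, mul_comm (T.nm f _), ← T.tr_mul_res, res_nm_self]
  congr 1
  ring

theorem exists_frac_res {X Y : FinGSet.{u} G} (f : X →[G] Y) (z : LocObj T w X) :
    ∃ a t, ∃ ht : t ∈ T.inverted w Y, z = frac a (T.res f t) (T.inverted_res w f ht) := by
  obtain ⟨a, s, hs, rfl⟩ := exists_frac z
  refine ⟨a * T.cofactor f s, T.nm f s, T.inverted_nm w f hs, frac_eq_of_eq ?_⟩
  rw [res_nm_self]
  ring

theorem frac_congr {X : FinGSet.{u} G} {a b s r : T.obj X} {hs : s ∈ T.inverted w X}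
    {hr : r ∈ T.inverted w X} (h₁ : a = b) (h₂ : s = r) : frac a s hs = frac b r hr := by
  subst h₁ h₂
  rfl

variable (T w)

/-- The Tambara functor of fractions. -/
def loc : TambaraFunctor.{u, v} G where
  obj := LocObj T w
  res := locRes T w
  tr := locTr T w
  nm := locNm T w
  res_id z := by
    obtain ⟨a, s, hs, rfl⟩ := exists_frac z
    exact frac_congr (T.res_id a) (T.res_id s)
  tr_id z := by
    obtain ⟨a, s, hs, rfl⟩ := exists_frac z
    rw [locTr_frac _ a s hs hs (T.res_id s).symm, T.tr_id]
  nm_id z := by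
    obtain ⟨a, s, hs, rfl⟩ := exists_frac z
    exact frac_congr (T.nm_id a) (T.nm_id s)
  res_comp f g z := by
    obtain ⟨a, s, hs, rfl⟩ := exists_frac z
    exact frac_congr (T.res_comp f g a) (T.res_comp f g s)
  tr_comp f g z := by
    obtain ⟨a, t, ht, rfl⟩ := exists_frac_res (f.comp g) z
    rw [locTr_frac _ a t ht _ rfl,
      locTr_frac g a (T.res f t) (T.inverted_res w f ht) _ (T.res_comp f g t),
      locTr_frac f _ t ht _ rfl, T.tr_comp]
  nm_comp f g z := by
    obtain ⟨a, s, hs, rfl⟩ := exists_frac z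
    exact frac_congr (T.nm_comp f g a) (T.nm_comp f g s)
  res_tr {P X X' Y g' f' f g} hp z := by
    obtain ⟨a, t, ht, rfl⟩ := exists_frac_res g z
    have hfg : f.comp g' = g.comp f' := by
      ext p
      exact hp.comm p
    rw [locTr_frac g a t ht _ rfl, locRes_frac, locRes_frac,
      locTr_frac g' (T.res f' a) (T.res f t) (T.inverted_res w f ht) _
        (by rw [← T.res_comp, ← T.res_comp, hfg])]
    exact frac_congr (T.res_tr hp a) rfl
  res_nm {P X X' Y g' f' f g} hp z := by
    obtain ⟨a, s, hs, rfl⟩ := exists_frac z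
    exact frac_congr (T.res_nm hp a) (T.res_nm hp s)
  nm_tr {X Y Z E P f g e q p} hE z := by
    obtain ⟨a, t, ht, rfl⟩ := exists_frac_res g z
    rw [locTr_frac g a t ht _ rfl, locNm_frac, locRes_frac, locNm_frac,
      locTr_frac p _ (T.nm f t) (T.inverted_nm w f ht) _ ?_]
    · exact frac_congr (T.nm_tr hE a) rfl
    · have hp : IsPullback q (g.comp e) p f := hE.isPullback
      rw [T.res_nm hp, T.res_comp]
  subsingleton_of_isEmpty X h := by
    have := T.subsingleton_of_isEmpty X h
    refine ⟨fun y z => ?_⟩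
    obtain ⟨a, s, hs, rfl⟩ := exists_frac y
    obtain ⟨b, r, hr, rfl⟩ := exists_frac z
    exact frac_congr (Subsingleton.elim _ _) (Subsingleton.elim _ _)
  bijective_sum X Y := by
    constructor
    · intro y z h
      obtain ⟨a, s, hs, rfl⟩ := exists_frac y
      obtain ⟨b, r, hr, rfl⟩ := exists_frac z
      obtain ⟨c, hc, hc'⟩ := frac_eq.1 (congrArg Prod.fst h)
      obtain ⟨d, hd, hd'⟩ := frac_eq.1 (congrArg Prod.snd h)
      obtain ⟨k, rfl, rfl⟩ := T.exists_pair c d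
      refine frac_eq.2 ⟨k, T.inverted_pair w hc hd, T.sum_ext ?_ ?_⟩
      · simpa only [T.res_mul] using hc'
      · simpa only [T.res_mul] using hd'
    · rintro ⟨y, z⟩
      obtain ⟨a, s, hs, rfl⟩ := exists_frac y
      obtain ⟨b, r, hr, rfl⟩ := exists_frac z
      obtain ⟨c, rfl, rfl⟩ := T.exists_pair a b
      obtain ⟨k, rfl, rfl⟩ := T.exists_pair s r
      exact ⟨frac c k (T.inverted_pair w hs hr), rfl⟩
  tr_fold X z := by
    obtain ⟨a, t, ht, rfl⟩ := exists_frac_res (fold X) z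
    rw [locTr_frac _ a t ht _ rfl, T.tr_fold, locRes_frac, locRes_frac]
    have h₁ : T.res (inl X X) (T.res (fold X) t) = t := by
      rw [← T.res_comp]
      exact T.res_id t
    have h₂ : T.res (inr X X) (T.res (fold X) t) = t := by
      rw [← T.res_comp]
      exact T.res_id t
    rw [frac_congr (hr := ht) rfl h₁, frac_congr (hr := ht) rfl h₂, Localization.add_mk_self]
  nm_fold X z := by
    obtain ⟨a, s, hs, rfl⟩ := exists_frac z
    rw [locNm_frac, locRes_frac, locRes_frac, Localization.mk_mul]
    exact frac_congr (T.nm_fold X a) (T.nm_fold X s)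

/-- The morphism `a ↦ a / 1` to the Tambara functor of fractions. -/
def toLoc : Hom T (loc T w) where
  app _ a := frac a 1 (one_mem _)
  app_res f _ := frac_congr rfl (T.res_one f).symm
  app_tr f a := (locTr_frac f a 1 (one_mem _) (one_mem _) (T.res_one f).symm).symm
  app_nm f _ := frac_congr rfl (T.nm_one f).symm

/-- The fraction `a / s`, as an element of the Tambara functor of fractions. -/
def locFrac {X : FinGSet.{u} G} (a s : T.obj X) (hs : s ∈ T.inverted w X) : (loc T w).obj X :=
  frac a s hs

theorem frac_mul_toLoc {X : FinGSet.{u} G} (a s : T.obj X) (hs : s ∈ T.inverted w X) :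
    locFrac T w a s hs * (toLoc T w).app X s = (toLoc T w).app X a := by
  refine (Localization.mk_mul a s ⟨s, hs⟩ ⟨1, one_mem _⟩).trans (frac_eq_of_eq ?_)
  simp [mul_comm]

theorem isUnit_toLoc {X : FinGSet.{u} G} {s : T.obj X} (hs : s ∈ T.inverted w X) :
    IsUnit ((toLoc T w).app X s) := by
  refine IsUnit.of_mul_eq_one_right (locFrac T w 1 s hs) ?_
  rw [frac_mul_toLoc]
  exact (toLoc T w).map_one X

theorem isLocalizationAway_toLoc : IsLocalizationAway w (toLoc T w) where
  isUnit := isUnit_toLoc T w fun _ _ h => h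
  existsUnique S ψ hψ := by
    have hu (X : FinGSet.{u} G) (y : T.inverted w X) : IsUnit (ψ.ringHom X y) := y.2 S ψ hψ
    let χ (X : FinGSet.{u} G) : LocObj T w X →+* S.obj X := IsLocalization.lift (hu X)
    have hχ {X : FinGSet.{u} G} (a s : T.obj X) (hs : s ∈ T.inverted w X) :
        χ X (frac a s hs) * ψ.app X s = ψ.app X a := by
      have h := IsLocalization.lift_mk'_spec (S := LocObj T w X) (g := ψ.ringHom X) (hg := hu X) a
        (χ X (frac a s hs)) (⟨s, hs⟩ : T.inverted w X)
      rw [← Localization.mk_eq_mk'] at h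
      rw [mul_comm]
      exact (h.1 rfl).symm
    refine ⟨⟨fun X => χ X, ?_, ?_, ?_⟩, ?_, ?_⟩
    · intro X Y f z
      obtain ⟨a, s, hs, rfl⟩ := exists_frac (T := T) (w := w) z
      have h := hχ (T.res f a) (T.res f s) (T.inverted_res w f hs)
      refine (T.inverted_res w f hs S ψ hψ).mul_right_cancel (h.trans ?_)
      rw [ψ.app_res, ψ.app_res, ← S.res_mul, hχ]
    · intro X Y f z
      obtain ⟨a, t, ht, rfl⟩ := exists_frac_res (T := T) (w := w) f z
      refine (ht S ψ hψ).mul_right_cancel ?_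
      have h := locTr_frac f a t ht (T.inverted_res w f ht) rfl
      refine (congrArg (fun k => χ Y k * ψ.app Y t) h).trans ((hχ _ _ ht).trans ?_)
      rw [← S.tr_mul_res, ← ψ.app_res, hχ, ψ.app_tr]
    · intro X Y f z
      obtain ⟨a, s, hs, rfl⟩ := exists_frac (T := T) (w := w) z
      have h := hχ (T.nm f a) (T.nm f s) (T.inverted_nm w f hs)
      refine (T.inverted_nm w f hs S ψ hψ).mul_right_cancel (h.trans ?_)
      rw [ψ.app_nm, ψ.app_nm, ← S.nm_mul, hχ]
    · refine Hom.ext ?_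
      funext X a
      have h := hχ a 1 (one_mem _)
      rw [ψ.map_one, mul_one] at h
      exact h
    · intro χ' h'
      refine Hom.ext ?_
      funext X z
      obtain ⟨a, s, hs, rfl⟩ := exists_frac (T := T) (w := w) z
      refine (hs S ψ hψ).mul_right_cancel (Eq.trans ?_ (hχ a s hs).symm)
      subst h'
      exact (χ'.map_mul _ _).symm.trans (congrArg (χ'.app X) (frac_mul_toLoc T w a s hs))

theorem exists_isLocalizationAway :
    ∃ (L : TambaraFunctor.{u, v} G) (φ : Hom T L), IsLocalizationAway w φ :=
  ⟨loc T w, toLoc T w, isLocalizationAway_toLoc T w⟩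

end Localization

/-- The localization `T[1/x]`. -/
noncomputable def away (T : TambaraFunctor.{u, v} G) {X : FinGSet.{u} G} (x : T.obj X) :
    TambaraFunctor.{u, v} G :=
  (T.exists_isLocalizationAway x).choose

/-- The localization map `T → T[1/x]`. -/
noncomputable def toAway (T : TambaraFunctor.{u, v} G) {X : FinGSet.{u} G} (x : T.obj X) :
    Hom T (T.away x) :=
  (T.exists_isLocalizationAway x).choose_spec.choose

theorem isLocalizationAway_toAway (T : TambaraFunctor.{u, v} G) {X : FinGSet.{u} G}
    (x : T.obj X) : IsLocalizationAway x (T.toAway x) :=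
  (T.exists_isLocalizationAway x).choose_spec.choose_spec

variable [Finite G]

/-- `T` is the zero Tambara functor: `T(G/K) = 0` for all `K ≤ G`. -/
def IsZero (T : TambaraFunctor.{u, v} G) : Prop :=
  ∀ K : Subgroup G, Subsingleton (T.obj (FinGSet.orbit K))

/-- `x ∈ T(G/H)` is a kilpotent if `T[1/x] = 0`. -/
def IsKilpotent (T : TambaraFunctor.{u, v} G) {H : Subgroup G} (x : T.obj (FinGSet.orbit H)) :
    Prop :=
  (T.away x).IsZero

/-- The restriction `res^K_H : T(G/K) → T(G/H)` for `H ≤ K`. -/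
def restrict (T : TambaraFunctor.{u, v} G) {H K : Subgroup G} (h : H ≤ K) :
    T.obj (FinGSet.orbit K) → T.obj (FinGSet.orbit H) :=
  T.res (FinGSet.quotientMap h)

/-- The conjugation `conj_{g,H} : T(G/H) → T(G/K)` for `K = gHg⁻¹`, i.e. `S(T_c)` for the canonical
isomorphism `c : G/H → G/K`. -/
def conj (T : TambaraFunctor.{u, v} G) {H K : Subgroup G} (g : G)
    (h : ∀ a, a ∈ K ↔ g⁻¹ * a * g ∈ H) : T.obj (FinGSet.orbit H) → T.obj (FinGSet.orbit K) :=
  T.tr (FinGSet.conjMap g h)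

/-- The conjugation `conj_g : T(G/e) → T(G/e)`. -/
def conjBot (T : TambaraFunctor.{u, v} G) (g : G) :
    T.obj (FinGSet.orbit (⊥ : Subgroup G)) → T.obj (FinGSet.orbit (⊥ : Subgroup G)) :=
  T.conj g fun a => by
    rw [Subgroup.mem_bot, Subgroup.mem_bot, ← conj_eq_one_iff (a := g⁻¹), inv_inv]

end TambaraFunctor

section FiberProd

/-- The product of `a` over the fibre of `f` at `y`. -/
@[to_additive /-- The sum of `a` over the fibre of `f` at `y`. -/]
noncomputable def fiberProd {X Y M : Type*} [CommMonoid M] (f : X → Y) (a : X → M) (y : Y) : M :=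
  ∏ᶠ x : {x // f x = y}, a x

variable {M : Type*} [CommMonoid M]

@[to_additive]
theorem fiberProd_id {X : Type*} (a : X → M) : fiberProd (fun x => x) a = a := by
  funext y
  have : Unique {x : X // x = y} := ⟨⟨⟨y, rfl⟩⟩, fun x => Subtype.ext x.2⟩
  exact (finprod_unique _).trans (congrArg a (default : {x : X // x = y}).2)

@[to_additive]
theorem fiberProd_comp {X Y Z : Type*} [Finite X] [Finite Y] (f : Y → Z) (g : X → Y) (a : X → M) :
    fiberProd (fun x => f (g x)) a = fiberProd f (fiberProd g a) := by
  classical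
  have := Fintype.ofFinite X
  have := Fintype.ofFinite Y
  funext z
  simp only [fiberProd]
  rw [finprod_eq_prod_of_fintype]
  simp_rw [finprod_eq_prod_of_fintype]
  rw [← Fintype.prod_sigma']
  refine Fintype.prod_equiv
    ⟨fun x => ⟨⟨g x.1, x.2⟩, ⟨x.1, rfl⟩⟩, fun s => ⟨s.2.1, by rw [s.2.2]; exact s.1.2⟩,
      fun x => rfl, ?_⟩ _ _ fun x => rfl
  have h : ∀ (y : Y) (hy : f y = z) (x : X) (hx : g x = y),
      (⟨⟨g x, by rw [hx, hy]⟩, ⟨x, rfl⟩⟩ : Σ y : {y // f y = z}, {x // g x = y.1}) =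
        ⟨⟨y, hy⟩, ⟨x, hx⟩⟩ := by
    rintro _ _ _ rfl
    rfl
  exact fun s => h s.1.1 s.1.2 s.2.1 s.2.2

@[to_additive]
theorem fiberProd_pullback {P X X' Y : Type*} {g' : P → X} {f' : P → X'} {f : X → Y}
    {g : X' → Y} (comm : ∀ p, f (g' p) = g (f' p))
    (h : ∀ x x', f x = g x' → ∃! p, g' p = x ∧ f' p = x') (a : X' → M) (x : X) :
    fiberProd g a (f x) = fiberProd g' (fun p => a (f' p)) x := by
  refine (finprod_eq_of_bijective
    (fun p : {p // g' p = x} => (⟨f' p.1, by rw [← comm, p.2]⟩ : {x' // g x' = f x}))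
    ⟨?_, ?_⟩ fun p => rfl).symm
  · rintro ⟨p, hp⟩ ⟨r, hr⟩ hpr
    exact Subtype.ext ((h x (f' p) (by rw [← comm, hp])).unique ⟨hp, rfl⟩
      ⟨hr, (congrArg Subtype.val hpr).symm⟩)
  · rintro ⟨x', hx'⟩
    obtain ⟨p, ⟨h₁, h₂⟩, -⟩ := h x x' hx'.symm
    exact ⟨⟨p, h₁⟩, Subtype.ext h₂⟩

@[to_additive]
theorem fiberProd_fold {X : Type*} (a : X ⊕ X → M) (x : X) :
    fiberProd (Sum.elim id id : X ⊕ X → X) a x = a (Sum.inl x) * a (Sum.inr x) := by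
  refine (finprod_eq_of_bijective (f := fun b : Bool => cond b (a (Sum.inl x)) (a (Sum.inr x)))
    (fun b => ⟨cond b (Sum.inl x) (Sum.inr x), by cases b <;> rfl⟩) ⟨?_, ?_⟩ ?_).symm.trans ?_
  · rintro (_ | _) (_ | _) h
    · rfl
    · cases congrArg Subtype.val h
    · cases congrArg Subtype.val h
    · rfl
  · rintro ⟨y | y, h⟩
    · exact ⟨true, Subtype.ext (congrArg Sum.inl (h : y = x).symm)⟩
    · exact ⟨false, Subtype.ext (congrArg Sum.inr (h : y = x).symm)⟩
  · rintro (_ | _) <;> rfl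
  · rw [finprod_eq_prod_of_fintype, Fintype.prod_bool]
    rfl

/-- Distributivity of products over sums, along an exponential diagram. -/
theorem fiberProd_fiberSum {R : Type*} [CommRing R] {X Y Z E P : Type*} [Finite X] [Finite Y]
    {f : Y → Z} {g : X → Y} {e : E → X} {q : E → P} {p : P → Z}
    (comm : ∀ a, p (q a) = f (g (e a)))
    (hpb : ∀ b y, p b = f y → ∃! a, q a = b ∧ g (e a) = y)
    (hs : ∀ (z : Z) (s : {y : Y // f y = z} → X), (∀ y, g (s y) = y) →
      ∃! b : P, p b = z ∧ ∀ (a : E) (_ : f (g (e a)) = z) , q a = b → e a = s ⟨g (e a), ‹_›⟩)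
    (a : X → R) :
    fiberProd f (fiberSum g a) = fiberSum p (fiberProd q fun c => a (e c)) := by
  classical
  have := Fintype.ofFinite X
  have := Fintype.ofFinite Y
  funext z
  have hsec (b : {b // p b = z}) (y : {y // f y = z}) :
      ∃ c : E, q c = b.1 ∧ g (e c) = y.1 := by
    obtain ⟨c, hc, -⟩ := hpb b.1 y.1 (b.2.trans y.2.symm)
    exact ⟨c, hc⟩
  choose t ht₁ ht₂ using hsec
  simp only [fiberProd, fiberSum]
  rw [finprod_eq_prod_of_fintype]
  simp_rw [finsum_eq_sum_of_fintype (α := {x // g x = _})]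
  rw [Fintype.prod_sum, ← finsum_eq_sum_of_fintype]
  refine (finsum_eq_of_bijective
    (fun b : {b // p b = z} => fun y : {y // f y = z} =>
      (⟨e (t b y), ht₂ b y⟩ : {x // g x = y.1})) ⟨?_, ?_⟩ ?_).symm
  · intro b b' h
    have h' (y) : e (t b y) = e (t b' y) := congrArg Subtype.val (congrFun h y)
    have key (b₀ : {b // p b = z}) (c : E) (hc : f (g (e c)) = z) (hq : q c = b₀.1) :
        e c = e (t b₀ ⟨g (e c), hc⟩) :=
      congrArg e ((hpb b₀.1 (g (e c)) (b₀.2.trans hc.symm)).unique ⟨hq, rfl⟩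
        ⟨ht₁ _ _, ht₂ b₀ ⟨g (e c), hc⟩⟩)
    refine Subtype.ext ((hs z (fun y => e (t b y)) fun y => ht₂ b y).unique
      ⟨b.2, fun c hc hq => key b c hc hq⟩ ⟨b'.2, fun c hc hq => ?_⟩)
    exact (key b' c hc hq).trans (h' _).symm
  · intro s
    obtain ⟨b, ⟨hb, hb'⟩, -⟩ := hs z (fun y => (s y).1) fun y => (s y).2
    refine ⟨⟨b, hb⟩, funext fun y => Subtype.ext ?_⟩
    have hy : g (e (t ⟨b, hb⟩ y)) = y.1 := ht₂ _ _
    refine (hb' (t ⟨b, hb⟩ y) (by rw [hy, y.2]) (ht₁ _ _)).trans ?_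
    exact congrArg (fun w => (s w).1) (Subtype.ext hy)
  · intro b
    rw [← finprod_eq_prod_of_fintype]
    refine (finprod_eq_of_bijective
      (fun y : {y // f y = z} => (⟨t b y, ht₁ b y⟩ : {c // q c = b.1})) ⟨?_, ?_⟩
      fun y => rfl).symm
    · intro y y' h
      have := congrArg (fun c => g (e c.1)) h
      simp only [ht₂] at this
      exact Subtype.ext this
    · rintro ⟨c, hc⟩
      have hz : f (g (e c)) = z := by rw [← comm, hc, b.2]
      exact ⟨⟨g (e c), hz⟩, Subtype.ext ((hpb b.1 (g (e c)) (b.2.trans hz.symm)).unique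
        ⟨ht₁ _ _, ht₂ b ⟨g (e c), hz⟩⟩ ⟨hc, rfl⟩)⟩

end FiberProd

namespace TambaraFunctor

open FinGSet

/-- The Tambara functor coinduced from a ring `R`: its value at `X` is the ring of all functions
`X → R`. The shrinking of `X` only adjusts universes. -/
noncomputable def coinduced (G : Type u) [Group G] (R : Type v) [CommRing R] :
    TambaraFunctor.{u, v} G where
  obj X := Shrink.{v} X → R
  res {X Y} f a x := a (equivShrink.{v} Y (f ((equivShrink.{v} X).symm x)))
  tr {X Y} f a y := fiberSum f (fun x => a (equivShrink.{v} X x)) ((equivShrink.{v} Y).symm y)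
  nm {X Y} f a y := fiberProd f (fun x => a (equivShrink.{v} X x)) ((equivShrink.{v} Y).symm y)
  res_id a := by
    funext x
    simp
  tr_id {X} a := by
    funext y
    have h := fiberSum_id (fun x : X => a (equivShrink.{v} X x))
    exact (congrFun h _).trans (by simp)
  nm_id {X} a := by
    funext y
    have h := fiberProd_id (fun x : X => a (equivShrink.{v} X x))
    exact (congrFun h _).trans (by simp)
  res_comp f g a := by
    funext x
    simp
  tr_comp {X Y Z} f g a := by
    funext z
    simp only [Equiv.symm_apply_apply]
    exact congrFun (fiberSum_comp f g fun x : X => a (equivShrink.{v} X x)) _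
  nm_comp {X Y Z} f g a := by
    funext z
    simp only [Equiv.symm_apply_apply]
    exact congrFun (fiberProd_comp f g fun x : X => a (equivShrink.{v} X x)) _
  res_tr {P X X' Y g' f' f g} h a := by
    funext x
    simp only [Equiv.symm_apply_apply]
    exact fiberSum_pullback h.comm h.existsUnique _ _
  res_nm {P X X' Y g' f' f g} h a := by
    funext x
    simp only [Equiv.symm_apply_apply]
    exact fiberProd_pullback h.comm h.existsUnique _ _
  nm_tr {X Y Z E P f g e q p} h a := by
    funext z
    simp only [Equiv.symm_apply_apply]
    exact congrFun (fiberProd_fiberSum (f := f) (g := g) (e := e) (q := q) (p := p)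
      h.isPullback.comm h.isPullback.existsUnique h.existsUnique
      fun x : X => a (equivShrink.{v} X x)) _
  subsingleton_of_isEmpty X hX :=
    ⟨fun a b => funext fun x => (hX.false ((equivShrink.{v} X).symm x)).elim⟩
  bijective_sum X Y := by
    constructor
    · intro a b h
      funext c
      obtain ⟨c, rfl⟩ := (equivShrink.{v} (X.sum Y)).surjective c
      rcases c with x | y
      · have := congrFun (congrArg Prod.fst h) (equivShrink.{v} X x)
        simp only [Equiv.symm_apply_apply] at this
        exact this
      · have := congrFun (congrArg Prod.snd h) (equivShrink.{v} Y y)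
        simp only [Equiv.symm_apply_apply] at this
        exact this
    · rintro ⟨a, b⟩
      refine ⟨fun c => Sum.elim (fun x => a (equivShrink.{v} X x)) (fun y => b (equivShrink.{v} Y y))
        ((equivShrink.{v} (X.sum Y)).symm c), Prod.ext (funext fun x => ?_) (funext fun y => ?_)⟩
      · simp only [Equiv.symm_apply_apply]
        exact congrArg a ((equivShrink.{v} X).apply_symm_apply x)
      · simp only [Equiv.symm_apply_apply]
        exact congrArg b ((equivShrink.{v} Y).apply_symm_apply y)
  tr_fold X c := by
    funext x
    exact fiberSum_fold (fun x => c (equivShrink.{v} (X.sum X) x)) _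
  nm_fold X c := by
    funext x
    exact fiberProd_fold (fun x => c (equivShrink.{v} (X.sum X) x)) _

section Copies

variable {G : Type u} [Group G]

/-- The disjoint union of copies of `Z` indexed by `I`. -/
def _root_.FinGSet.copies (I : Type u) [Finite I] (Z : FinGSet.{u} G) : FinGSet.{u} G where
  carrier := I × Z
  action :=
    { smul := fun g p => (p.1, g • p.2)
      one_smul := fun _ => Prod.ext rfl (one_smul G _)
      mul_smul := fun g h _ => Prod.ext rfl (mul_smul g h _) }

/-- The map out of `copies I Z` with components `f i`. -/
def _root_.FinGSet.copiesDesc {I : Type u} [Finite I] {Z W : FinGSet.{u} G} (f : I → (Z →[G] W)) :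
    copies I Z →[G] W where
  toFun p := f p.1 p.2
  map_smul' g p := map_smul (f p.1) g p.2

/-- The inclusion of a copy of `Z`. -/
def _root_.FinGSet.copiesInc {I : Type u} [Finite I] (Z : FinGSet.{u} G) (i : I) :
    Z →[G] copies I Z where
  toFun z := (i, z)
  map_smul' _ _ := rfl

/-- The projection of `copies I Z` to `Z`. -/
def _root_.FinGSet.copiesProj (I : Type u) [Finite I] (Z : FinGSet.{u} G) : copies I Z →[G] Z :=
  copiesDesc fun _ => MulActionHom.id G

/-- The map of copies of `Z` given by a map of index sets. -/
def _root_.FinGSet.copiesMap {I J : Type u} [Finite I] [Finite J] (Z : FinGSet.{u} G)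
    (k : I → J) : copies I Z →[G] copies J Z :=
  copiesDesc fun i => copiesInc Z (k i)

variable (T : TambaraFunctor.{u, v} G)

theorem tr_eq_res {X Y : FinGSet.{u} G} (f : X →[G] Y) (g : Y →[G] X) (hfg : ∀ y, f (g y) = y)
    (hgf : ∀ x, g (f x) = x) (a : T.obj X) : T.tr f a = T.res g a := by
  have hp : IsPullback (MulActionHom.id G : X →[G] X) (MulActionHom.id G) f f :=
    ⟨fun _ => rfl, fun x x' h => ⟨x, ⟨rfl, (Function.LeftInverse.injective hgf) h⟩,
      fun _ hp => hp.1⟩⟩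
  have hid : f.comp g = MulActionHom.id G := by
    ext y
    exact hfg y
  have h := congrArg (T.res g) (T.res_tr hp a)
  rwa [← T.res_comp, hid, T.res_id, T.tr_id, T.res_id] at h

theorem nm_eq_res {X Y : FinGSet.{u} G} (f : X →[G] Y) (g : Y →[G] X) (hfg : ∀ y, f (g y) = y)
    (hgf : ∀ x, g (f x) = x) (a : T.obj X) : T.nm f a = T.res g a := by
  have hp : IsPullback (MulActionHom.id G : X →[G] X) (MulActionHom.id G) f f :=
    ⟨fun _ => rfl, fun x x' h => ⟨x, ⟨rfl, (Function.LeftInverse.injective hgf) h⟩,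
      fun _ hp => hp.1⟩⟩
  have hid : f.comp g = MulActionHom.id G := by
    ext y
    exact hfg y
  have h := congrArg (T.res g) (T.res_nm hp a)
  rwa [← T.res_comp, hid, T.res_id, T.nm_id, T.res_id] at h

theorem tr_fromEmpty (X : FinGSet.{u} G) (t : T.obj (FinGSet.empty G)) :
    T.tr (fromEmpty X) t = 0 := by
  have := T.subsingleton_of_isEmpty (FinGSet.empty G) (inferInstanceAs (IsEmpty PEmpty))
  have h := T.tr_add (fromEmpty X) t t
  rwa [Subsingleton.elim (t + t) t, left_eq_add] at h

/-- Norms along surjections preserve zero. -/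
theorem nm_zero {X Y : FinGSet.{u} G} (f : X →[G] Y) (hf : Function.Surjective f) :
    T.nm f 0 = 0 := by
  have hE : IsExponential f (fromEmpty X) (MulActionHom.id G) (MulActionHom.id G)
      (fromEmpty Y) := by
    refine ⟨⟨fun p => p.elim, fun p => p.elim⟩, fun z s _ => ?_⟩
    obtain ⟨x, hx⟩ := hf z
    exact PEmpty.elim (s ⟨x, hx⟩)
  have h := T.nm_tr hE 0
  rwa [tr_fromEmpty, tr_fromEmpty] at h

/-- The isomorphism `(I × Z) ⨿ Z → Option I × Z`. -/
def _root_.FinGSet.copiesOption (I : Type u) [Finite I] (Z : FinGSet.{u} G) :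
    (copies I Z).sum Z →[G] copies (Option I) Z :=
  desc (copiesMap Z some) (copiesInc Z none)

/-- The inverse of `copiesOption`. -/
def _root_.FinGSet.copiesOptionInv (I : Type u) [Finite I] (Z : FinGSet.{u} G) :
    copies (Option I) Z →[G] (copies I Z).sum Z :=
  copiesDesc fun i => match i with
    | some i => (inl (copies I Z) Z).comp (copiesInc Z i)
    | none => inr (copies I Z) Z

theorem copiesOption_inv (I : Type u) [Finite I] (Z : FinGSet.{u} G)
    (p : copies (Option I) Z) : copiesOption I Z (copiesOptionInv I Z p) = p := by
  rcases p with ⟨_ | i, z⟩ <;> rfl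

theorem copiesOptionInv_copiesOption (I : Type u) [Finite I] (Z : FinGSet.{u} G)
    (p : (copies I Z).sum Z) : copiesOptionInv I Z (copiesOption I Z p) = p := by
  rcases p with p | z <;> rfl

theorem copiesProj_option (I : Type u) [Finite I] (Z : FinGSet.{u} G) :
    copiesProj (Option I) Z =
      (desc (copiesProj I Z) (MulActionHom.id G)).comp (copiesOptionInv I Z) := by
  ext p
  rcases p with ⟨_ | i, z⟩ <;> rfl

theorem tr_copiesProj (I : Type u) [Finite I] (Z : FinGSet.{u} G) (c : T.obj (copies I Z)) :
    T.tr (copiesProj I Z) c = ∑ᶠ i, T.res (copiesInc Z i) c := by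
  have H : ∀ [Finite I] (c : T.obj (copies I Z)),
      T.tr (copiesProj I Z) c = ∑ᶠ i, T.res (copiesInc Z i) c := by
    refine Finite.induction_empty_option
      (P := fun I => ∀ [Finite I] (c : T.obj (copies I Z)),
        T.tr (copiesProj I Z) c = ∑ᶠ i, T.res (copiesInc Z i) c) ?_ ?_ ?_ I
    · intro I J k hI _ c
      have : Finite I := .of_equiv J k.symm
      have hc : copiesProj J Z = (copiesProj I Z).comp (copiesMap Z k.symm) := rfl
      rw [hc, T.tr_comp, T.tr_eq_res (copiesMap Z k.symm) (copiesMap Z k)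
        (fun y => Prod.ext (k.symm_apply_apply _) rfl)
        (fun y => Prod.ext (k.apply_symm_apply _) rfl), hI]
      refine finsum_eq_of_bijective k k.bijective fun i => ?_
      rw [← T.res_comp]
      rfl
    · intro _ c
      have hc : copiesProj PEmpty Z = (fromEmpty Z).comp
          (⟨fun p => p.1.elim, fun _ p => p.1.elim⟩ :
            copies PEmpty.{u + 1} Z →[G] FinGSet.empty G) := by
        ext p
        exact p.1.elim
      rw [hc, T.tr_comp, tr_fromEmpty, finsum_of_isEmpty]
    · intro I _ hI _ c
      rw [copiesProj_option, T.tr_comp, T.tr_eq_res _ (copiesOption I Z)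
        (copiesOptionInv_copiesOption I Z) (copiesOption_inv I Z), T.tr_desc, T.tr_id, hI,
        finsum_eq_sum_of_fintype, finsum_eq_sum_of_fintype, Fintype.sum_option, add_comm]
      congr 1
      · rw [← T.res_comp]
        rfl
      · refine Finset.sum_congr rfl fun i _ => ?_
        rw [← T.res_comp, ← T.res_comp]
        rfl
  exact H c

theorem nm_copiesProj (I : Type u) [Finite I] (Z : FinGSet.{u} G) (c : T.obj (copies I Z)) :
    T.nm (copiesProj I Z) c = ∏ᶠ i, T.res (copiesInc Z i) c := by
  have H : ∀ [Finite I] (c : T.obj (copies I Z)),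
      T.nm (copiesProj I Z) c = ∏ᶠ i, T.res (copiesInc Z i) c := by
    refine Finite.induction_empty_option
      (P := fun I => ∀ [Finite I] (c : T.obj (copies I Z)),
        T.nm (copiesProj I Z) c = ∏ᶠ i, T.res (copiesInc Z i) c) ?_ ?_ ?_ I
    · intro I J k hI _ c
      have : Finite I := .of_equiv J k.symm
      have hc : copiesProj J Z = (copiesProj I Z).comp (copiesMap Z k.symm) := rfl
      rw [hc, T.nm_comp, T.nm_eq_res (copiesMap Z k.symm) (copiesMap Z k)
        (fun y => Prod.ext (k.symm_apply_apply _) rfl)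
        (fun y => Prod.ext (k.apply_symm_apply _) rfl), hI]
      refine finprod_eq_of_bijective k k.bijective fun i => ?_
      rw [← T.res_comp]
      rfl
    · intro _ c
      have hc : copiesProj PEmpty Z = (fromEmpty Z).comp
          (⟨fun p => p.1.elim, fun _ p => p.1.elim⟩ :
            copies PEmpty.{u + 1} Z →[G] FinGSet.empty G) := by
        ext p
        exact p.1.elim
      rw [hc, T.nm_comp, nm_fromEmpty, finprod_of_isEmpty]
    · intro I _ hI _ c
      rw [copiesProj_option, T.nm_comp, T.nm_eq_res _ (copiesOption I Z)
        (copiesOptionInv_copiesOption I Z) (copiesOption_inv I Z), T.nm_desc, T.nm_id, hI,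
        finprod_eq_prod_of_fintype, finprod_eq_prod_of_fintype, Fintype.prod_option, mul_comm]
      congr 1
      · rw [← T.res_comp]
        rfl
      · refine Finset.prod_congr rfl fun i _ => ?_
        rw [← T.res_comp, ← T.res_comp]
        rfl
  exact H c

end Copies

end TambaraFunctor

namespace TambaraFunctor

open FinGSet

variable {G : Type u} [Group G] [Finite G]

/-- The map `G/e → X`, `g ↦ g • x`. -/
def _root_.FinGSet.point {X : FinGSet.{u} G} (x : X) : orbit (⊥ : Subgroup G) →[G] X where
  toFun := Quotient.lift (s := QuotientGroup.leftRel ⊥) (fun g : G => g • x) fun a b hab => by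
    have h := QuotientGroup.leftRel_apply.1 hab
    rw [Subgroup.mem_bot, inv_mul_eq_one] at h
    rw [h]
  map_smul' g y := by
    induction y using Quotient.inductionOn' with
    | h a => exact mul_smul g a x

theorem comp_point {X Y : FinGSet.{u} G} (f : X →[G] Y) (x : X) :
    f.comp (point x) = point (f x) := by
  ext y
  induction y using Quotient.inductionOn' with
  | h a => exact map_smul f a x

theorem isPullback_copiesProj_point {X Y : FinGSet.{u} G} (f : X →[G] Y) (y : Y) :
    IsPullback (copiesProj {x // f x = y} (orbit ⊥)) (copiesDesc fun x => point x.1)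
      (point y) f := by
  constructor
  · rintro ⟨⟨x, rfl⟩, z⟩
    exact (congrArg (fun k : orbit ⊥ →[G] Y => k z) (comp_point f x)).symm
  · intro z x' h
    induction z using Quotient.inductionOn' with
    | h a =>
      have h' : a • y = f x' := h
      refine ⟨(⟨a⁻¹ • x', by rw [map_smul, ← h', inv_smul_smul]⟩, Quotient.mk'' a),
        ⟨rfl, smul_inv_smul a x'⟩, ?_⟩
      rintro ⟨⟨x, hx⟩, w⟩ ⟨h₁, h₂⟩
      have h₁' : w = Quotient.mk'' a := h₁
      subst h₁'
      have h₂' : a • x = x' := h₂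
      refine Prod.ext (Subtype.ext ?_) rfl
      exact eq_inv_smul_iff.2 h₂'

variable (T : TambaraFunctor.{u, v} G)

theorem res_point_tr {X Y : FinGSet.{u} G} (f : X →[G] Y) (a : T.obj X) (y : Y) :
    T.res (point y) (T.tr f a) = fiberSum f (fun x => T.res (point x) a) y := by
  rw [T.res_tr (isPullback_copiesProj_point f y), tr_copiesProj]
  refine finsum_congr fun x => ?_
  rw [← T.res_comp]
  rfl

theorem res_point_nm {X Y : FinGSet.{u} G} (f : X →[G] Y) (a : T.obj X) (y : Y) :
    T.res (point y) (T.nm f a) = fiberProd f (fun x => T.res (point x) a) y := by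
  rw [T.res_nm (isPullback_copiesProj_point f y), nm_copiesProj]
  refine finprod_congr fun x => ?_
  rw [← T.res_comp]
  rfl

/-- The morphism to the coinduced Tambara functor adjoint to a ring homomorphism `T(G/e) → R`. -/
noncomputable def toCoinduced {R : Type v} [CommRing R]
    (φ : T.obj (orbit (⊥ : Subgroup G)) →+* R) : Hom T (coinduced G R) where
  app X a x := φ (T.res (point ((equivShrink.{v} X).symm x)) a)
  app_res {X Y} f a := by
    funext x
    change φ _ = φ (T.res (point ((equivShrink.{v} Y).symm (equivShrink.{v} Y _))) a)
    rw [Equiv.symm_apply_apply, ← comp_point, T.res_comp]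
  app_tr {X Y} f a := by
    funext y
    change φ _ = fiberSum f
      (fun x => φ (T.res (point ((equivShrink.{v} X).symm (equivShrink.{v} X x))) a)) _
    simp only [Equiv.symm_apply_apply]
    rw [res_point_tr]
    exact map_finsum φ (Set.toFinite _)
  app_nm {X Y} f a := by
    funext y
    change φ _ = fiberProd f
      (fun x => φ (T.res (point ((equivShrink.{v} X).symm (equivShrink.{v} X x))) a)) _
    simp only [Equiv.symm_apply_apply]
    rw [res_point_nm]
    exact map_finprod φ (Set.toFinite _)

/-- The elements `conj_g res^H_e x` are the restrictions of `x` along the maps `G/e → G/H`. -/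
theorem conjBot_restrict {H : Subgroup G} (x : T.obj (orbit H)) (g : G) :
    T.conjBot g (T.restrict bot_le x) =
      T.res (point (Quotient.mk'' g : G ⧸ H)) x := by
  have h (g : G) (a : G) : a ∈ (⊥ : Subgroup G) ↔ g⁻¹ * a * g ∈ (⊥ : Subgroup G) := by
    rw [Subgroup.mem_bot, Subgroup.mem_bot, ← conj_eq_one_iff (a := g⁻¹), inv_inv]
  have hinv (g : G) (y : orbit (⊥ : Subgroup G)) :
      conjMap g (h g) (conjMap g⁻¹ (h g⁻¹) y) = y := by
    induction y using Quotient.inductionOn' with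
    | h a => exact congrArg Quotient.mk'' (by simp : a * g⁻¹⁻¹ * g⁻¹ = a)
  have hinv' (y : orbit (⊥ : Subgroup G)) :
      conjMap g⁻¹ (h g⁻¹) (conjMap g (h g) y) = y := by
    induction y using Quotient.inductionOn' with
    | h a => exact congrArg Quotient.mk'' (by simp : a * g⁻¹ * g⁻¹⁻¹ = a)
  refine (T.tr_eq_res (conjMap g (h g)) (conjMap g⁻¹ (h g⁻¹)) (hinv g) hinv' _).trans ?_
  rw [restrict, ← T.res_comp]
  congr 1
  ext y
  induction y using Quotient.inductionOn' with
  | h a => exact congrArg Quotient.mk'' (by simp : a * g⁻¹⁻¹ = a * g)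

theorem quotientMap_surjective {H K : Subgroup G} (h : H ≤ K) :
    Function.Surjective (quotientMap h) := by
  intro y
  induction y using Quotient.inductionOn' with
  | h a => exact ⟨Quotient.mk'' a, rfl⟩

variable {T} in
theorem isZero_of_subsingleton (h : Subsingleton (T.obj (orbit (⊥ : Subgroup G)))) :
    T.IsZero := fun K => by
  refine subsingleton_of_zero_eq_one ?_
  rw [← T.nm_zero _ (quotientMap_surjective (bot_le : ⊥ ≤ K)), ← T.nm_one,
    Subsingleton.elim (0 : T.obj (orbit ⊥)) 1]

/-- A ring homomorphism `T(G/e) → R` that sends every `conj_g res^H_e x` to a unit induces a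
morphism to the coinduced Tambara functor that sends `x` to a unit. -/
theorem isUnit_toCoinduced {R : Type v} [CommRing R] {H : Subgroup G} (x : T.obj (orbit H))
    (φ : T.obj (orbit (⊥ : Subgroup G)) →+* R)
    (h : ∀ g : G, IsUnit (φ (T.conjBot g (T.restrict bot_le x)))) :
    IsUnit ((T.toCoinduced φ).app _ x) := by
  refine Pi.isUnit_iff.2 fun y => ?_
  obtain ⟨y, rfl⟩ := (equivShrink.{v} (orbit H)).surjective y
  change IsUnit (φ (T.res (point ((equivShrink.{v} (orbit H)).symm _)) x))
  rw [Equiv.symm_apply_apply]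
  induction y using Quotient.inductionOn' with
  | h g =>
    have := h g
    rwa [conjBot_restrict] at this

theorem Hom.app_conjBot_restrict {S : TambaraFunctor.{u, v} G} (φ : Hom T S) {H : Subgroup G}
    (x : T.obj (orbit H)) (g : G) :
    φ.app _ (T.conjBot g (T.restrict bot_le x)) =
      S.conjBot g (S.restrict bot_le (φ.app _ x)) := by
  rw [conjBot_restrict, conjBot_restrict, φ.app_res]

end TambaraFunctor

theorem theoremC {G : Type u} [Group G] [Fintype G] (T : TambaraFunctor.{u, v} G)
    (H : Subgroup G) (x : T.obj (FinGSet.orbit H)) :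
    T.IsKilpotent x ↔
      IsNilpotent (∏ g : G, T.conjBot g (T.restrict (bot_le : (⊥ : Subgroup G) ≤ H) x)) := by
  set P := ∏ g : G, T.conjBot g (T.restrict (bot_le : (⊥ : Subgroup G) ≤ H) x) with hP
  have hloc := T.isLocalizationAway_toAway x
  constructor
  · intro hx
    let R := Localization.Away P
    let φ := algebraMap (T.obj (FinGSet.orbit (⊥ : Subgroup G))) R
    have hφ : IsUnit (φ P) := IsLocalization.Away.algebraMap_isUnit P
    obtain ⟨χ, -, -⟩ := hloc.existsUnique _ (T.toCoinduced φ) <| T.isUnit_toCoinduced x φ fun g =>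
      isUnit_of_dvd_unit (map_dvd φ (Finset.dvd_prod_of_mem
        (fun g => T.conjBot g (T.restrict bot_le x)) (Finset.mem_univ g))) hφ
    have := hx ⊥
    have h₁ : (1 : (TambaraFunctor.coinduced G R).obj (FinGSet.orbit ⊥)) = 0 := by
      rw [← (χ.ringHom _).map_one, ← (χ.ringHom _).map_zero, Subsingleton.elim (1 : _) 0]
    have h₂ : φ 1 = φ 0 := by
      rw [φ.map_one, φ.map_zero]
      exact congrFun h₁ (equivShrink.{v} (FinGSet.orbit (⊥ : Subgroup G))
        (Quotient.mk'' 1 : G ⧸ (⊥ : Subgroup G)))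
    obtain ⟨⟨_, n, rfl⟩, hn⟩ := IsLocalization.exists_of_eq (M := Submonoid.powers P) h₂
    exact ⟨n, by simpa using hn⟩
  · intro hn
    refine TambaraFunctor.isZero_of_subsingleton ?_
    have hu : IsUnit ((T.toAway x).ringHom _ P) := by
      rw [hP, map_prod]
      refine IsUnit.prod_univ_iff.2 fun g => ?_
      change IsUnit ((T.toAway x).app _ _)
      rw [TambaraFunctor.Hom.app_conjBot_restrict, TambaraFunctor.conjBot_restrict]
      exact TambaraFunctor.isUnit_res _ _ hloc.isUnit
    have h₀ := (hn.map ((T.toAway x).ringHom _))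
    obtain ⟨n, h₀⟩ := h₀
    have h₁ := hu.pow n
    rw [h₀, isUnit_zero_iff] at h₁
    exact subsingleton_of_zero_eq_one h₁
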